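/- Work in the plane $\mathbb{R}^2$ with the Euclidean metric. Let $v_-=(-\tfrac12,0)$ and $v_+=(\tfrac12,0)$, and let the \emph{lune} be the intersection of the open discs of radius $1$ centered at $v_-$ and $v_+$. A \emph{template} is an open subset $A$ of the lune that contains the open segment $(v_-,v_+)$ and is invariant under the reflections $(x_1,x_2)\mapsto(-x_1,x_2)$ and $(x_1,x_2)\mapsto(x_1,-x_2)$. For distinct points $x,y$ let $A(x,y)$ be the image of $A$ under the composition of a translation, a rotation and a scaling that takes $(v_-,v_+)$ to $(x,y)$. The \emph{proximity graph} with template $A$ on a locally finite set $\mathcal V\subset\mathbb{R}^2$ has vertex set $\mathcal V$, and two distinct vertices $x,y$ are joined (by the straight segment from $x$ to $y$) if and only if $A(x,y)$ contains no point of $\mathcal V$. Let $\mathcal V$ be the Poisson point process of rate $1$ in the plane, let $A$ be a template, and let $c=\operatorname{area}(A)$. Then the proximity graph with template $A$ on $\mathcal V$ has normalized length (average network length per unit area) \[ L=\frac{\pi^{3/2}}{4c^{3/2}} \] and mean degree of its vertices \[ \bar\Delta=\frac{\pi}{c}. \] That is, for every Borel set $B\subset\mathbb{R}^2$ of finite area,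 the expected total length of the parts of the edges lying inside $B$ is $L\cdot\operatorname{area}(B)$, and the expected sum of the degrees of the vertices in $B$ is $\bar\Delta$ times the expected number of vertices in $B$. -/

import Mathlib

open MeasureTheory ProbabilityTheory
open scoped ENNReal NNReal

noncomputable section

/-- The Euclidean plane. -/
abbrev Plane : Type := EuclideanSpace ℝ (Fin 2)

/-! ### Templates and proximity graphs -/

/-- The point `v₋ = (-1/2, 0)`. -/
def vMinus : Plane := !₂[-(1 / 2 : ℝ), 0]

/-- The point `v₊ = (1/2, 0)`. -/
def vPlus : Plane := !₂[(1 / 2 : ℝ), 0]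

/-- The lune: the intersection of the open unit discs centred at `v₋` and `v₊`. -/
def lune : Set Plane := Metric.ball vMinus 1 ∩ Metric.ball vPlus 1

/-- A template: an open subset of the lune that contains the open segment `(v₋, v₊)` and is
invariant under the reflections in the two coordinate axes. -/
structure Template where
  carrier : Set Plane
  subset_lune : carrier ⊆ lune
  segment_subset : openSegment ℝ vMinus vPlus ⊆ carrier
  reflect_x : (fun p : Plane => (!₂[-p 0, p 1] : Plane)) '' carrier = carrier
  reflect_y : (fun p : Plane => (!₂[p 0, -p 1] : Plane)) '' carrier = carrier
  isOpen : IsOpen carrier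

/-- The area of a template. -/
def Template.area (A : Template) : ℝ := (volume A.carrier).toReal

/-- The composition of a translation, a rotation and a scaling that takes `(v₋, v₊)` to `(x, y)`:
it sends `(p₁, p₂)` to `(x + y)/2 + p₁ u + p₂ u'` where `u = y - x` and `u'` is `u` rotated by a
right angle counterclockwise. -/
def similarityTo (x y p : Plane) : Plane :=
  midpoint ℝ x y + p 0 • (y - x) + p 1 • (!₂[-(y - x) 1, (y - x) 0] : Plane)

/-- The set `A(x, y)`, the image of the template under the similarity taking `(v₋, v₊)` to
`(x, y)`. -/
def Template.between (A : Template) (x y : Plane) : Set Plane :=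
  similarityTo x y '' A.carrier

theorem similarityTo_vMinus (x y : Plane) : similarityTo x y vMinus = x := by
  ext i
  fin_cases i <;> simp [similarityTo, vMinus, midpoint_eq_smul_add] <;> ring

theorem similarityTo_vPlus (x y : Plane) : similarityTo x y vPlus = y := by
  ext i
  fin_cases i <;> simp [similarityTo, vPlus, midpoint_eq_smul_add] <;> ring

theorem Template.between_subset_swap (A : Template) (x y : Plane) :
    A.between x y ⊆ A.between y x := by
  rintro _ ⟨p, hp, rfl⟩
  have h1 : (!₂[-p 0, p 1] : Plane) ∈ A.carrier :=
    A.reflect_x ▸ Set.mem_image_of_mem _ hp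
  have h2 : (!₂[-p 0, -p 1] : Plane) ∈ A.carrier := by
    have h := Set.mem_image_of_mem (fun p : Plane => (!₂[p 0, -p 1] : Plane)) h1
    rw [A.reflect_y] at h
    simpa using h
  refine ⟨_, h2, ?_⟩
  ext i
  fin_cases i <;> simp [similarityTo, midpoint_eq_smul_add] <;> ring

theorem Template.between_swap (A : Template) (x y : Plane) :
    A.between x y = A.between y x :=
  Set.Subset.antisymm (A.between_subset_swap x y) (A.between_subset_swap y x)

/-- The proximity graph with template `A` on the vertex set `V`: two distinct vertices `x`, `y` are
joined iff `A(x, y)` contains no vertex. -/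
def proximityGraph (A : Template) (V : Set Plane) : SimpleGraph V where
  Adj x y := x ≠ y ∧ A.between x y ∩ V = ∅
  symm := ⟨fun x y h => ⟨h.1.symm, A.between_swap x y ▸ h.2⟩⟩
  loopless := ⟨fun _ h => h.1 rfl⟩

/-! ### The Poisson point process -/

/-- `X` is a Poisson point process of rate `1` in the plane under `P`: a random locally finite set
such that the number of points in a Borel set of finite area has the Poisson distribution with that
area as its mean, and the numbers of points in disjoint Borel sets are independent. -/
structure IsPoissonProcess {Ω : Type*} [MeasurableSpace Ω] (X : Ω → Set Plane) (P : Measure Ω) :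
    Prop where
  locallyFinite : ∀ (ω : Ω) (B : Set Plane), Bornology.IsBounded B → (X ω ∩ B).Finite
  measurable_count : ∀ B : Set Plane, MeasurableSet B → Measurable fun ω => (X ω ∩ B).encard
  law_count : ∀ B : Set Plane, MeasurableSet B → volume B ≠ ∞ →
    P.map (fun ω => (X ω ∩ B).encard) =
      (poissonMeasure (volume B).toNNReal).map (fun n : ℕ => (n : ℕ∞))
  indep_count : ∀ (n : ℕ) (B : Fin n → Set Plane), (∀ i, MeasurableSet (B i)) →
    Pairwise (Function.onFun Disjoint B) → iIndepFun (fun i ω => (X ω ∩ B i).encard) P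

/-! ### Normalized length and mean degree of a random spatial network -/

/-- The length (one-dimensional Hausdorff measure) of the part inside `B` of the straight segment
that realizes an edge. -/
def edgeLengthIn {V : Set Plane} (B : Set Plane) : Sym2 V → ℝ≥0∞ :=
  Sym2.lift ⟨fun x y => Measure.hausdorffMeasure 1 (segment ℝ (x : Plane) (y : Plane) ∩ B),
    fun x y => by simp only [segment_symm ℝ (x : Plane) (y : Plane)]⟩

/-- The total length of the part inside `B` of a network with straight edges. -/
def lengthIn {V : Set Plane} (G : SimpleGraph V) (B : Set Plane) : ℝ≥0∞ :=
  ∑' e : G.edgeSet, edgeLengthIn B (e : Sym2 V)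

/-- The sum of the degrees of the vertices in `B`. -/
def degreeSumIn {V : Set Plane} (G : SimpleGraph V) (B : Set Plane) : ℝ≥0∞ :=
  ∑' x : {x : V // (x : Plane) ∈ B}, ((G.neighborSet x).encard : ℝ≥0∞)

/-- The random network `G` has normalized length `L`: its average length per unit area is `L`, that
is, the expected network length inside each Borel set of finite area is `L` times the area. -/
def HasNormalizedLength {Ω : Type*} [MeasurableSpace Ω] (P : Measure Ω) {X : Ω → Set Plane}
    (G : ∀ ω, SimpleGraph (X ω)) (L : ℝ) : Prop :=
  0 ≤ L ∧ ∀ B : Set Plane, MeasurableSet B → volume B ≠ ∞ →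
    AEMeasurable (fun ω => lengthIn (G ω) B) P ∧
      ∫⁻ ω, lengthIn (G ω) B ∂P = ENNReal.ofReal L * volume B

/-- The random network `G` has mean degree `D`: the average degree of its vertices is `D`, that is,
for each Borel set of finite area the expected sum of the degrees of the vertices in it is `D` times
the expected number of these vertices. -/
def HasMeanDegree {Ω : Type*} [MeasurableSpace Ω] (P : Measure Ω) {X : Ω → Set Plane}
    (G : ∀ ω, SimpleGraph (X ω)) (D : ℝ) : Prop :=
  0 ≤ D ∧ ∀ B : Set Plane, MeasurableSet B → volume B ≠ ∞ →
    AEMeasurable (fun ω => degreeSumIn (G ω) B) P ∧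
      ∫⁻ ω, degreeSumIn (G ω) B ∂P =
        ENNReal.ofReal D * ∫⁻ ω, ((X ω ∩ B).encard : ℝ≥0∞) ∂P

end

/-! Both quantities are expectations of sums over ordered pairs of adjacent vertices, and both
follow from one second-moment formula of Campbell–Mecke type, `lintegral_tsum_edgePairs`: the mean
of the sum of `f (x, y)` over such pairs is the integral of `f (x, y) * exp (-c * ‖y - x‖ ^ 2)` over
all pairs of points. The exponential is the probability that `A(x, y)` is void: its area is `c * ‖y
- x‖ ^ 2`, and it contains neither `x` nor `y`. Taking for `f` the indicator of `x ∈ B` leaves the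
Gaussian integral `π / c` times the area of `B`. Taking for `f` the length of the segment inside `B`
gives twice the network length, and translation invariance reduces it to the integral of `‖z‖ * exp
(-c * ‖z‖ ^ 2)`.

The formula is derived from the laws of the counts alone. For disjoint bounded `C` and `D`, cut the
plane into finitely many cells and replace `A(x, y)` by the interior of the intersection of these
sets over the pair of cells containing `x` and `y`. This inner set misses both cells, so three
independent counts give an exact identity (`lintegral_cellSum`). Since `A` is open, the inner sets
fill `A(x, y)` as the cells shrink, and dominated convergence on both sides yields the formula for
`C ×ˢ D` (`pairMeasure_prod_of_disjoint`). Uniqueness of measures on rectangles extends it to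
measurable `f`, and countably many such products cover the complement of the diagonal. -/

noncomputable section

/-! ### Geometry of the sets `A(x, y)` -/

/-- The linear map `p ↦ p₁ u + p₂ u'`, with `u'` the vector `u` rotated by a right angle. -/
def rotateScale (u : Plane) : Plane →ₗ[ℝ] Plane :=
  Matrix.toLin (EuclideanSpace.basisFun (Fin 2) ℝ).toBasis
    (EuclideanSpace.basisFun (Fin 2) ℝ).toBasis !![u 0, -u 1; u 1, u 0]

theorem Plane.norm_sq (u : Plane) : ‖u‖ ^ 2 = u 0 ^ 2 + u 1 ^ 2 := by
  rw [EuclideanSpace.norm_sq_eq]; simp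

theorem det_rotateScale (u : Plane) : LinearMap.det (rotateScale u) = ‖u‖ ^ 2 := by
  rw [rotateScale, LinearMap.det_toLin, Matrix.det_fin_two, Plane.norm_sq]
  simp; ring

theorem rotateScale_apply (u p : Plane) :
    rotateScale u p = p 0 • u + p 1 • (!₂[-u 1, u 0] : Plane) := by
  rw [rotateScale, Matrix.toLin_apply]
  ext i
  fin_cases i <;> simp [Matrix.mulVec, dotProduct, Fin.sum_univ_two] <;> ring

theorem similarityTo_eq (x y : Plane) :
    similarityTo x y = (fun p => midpoint ℝ x y + p) ∘ rotateScale (y - x) := by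
  funext p
  simp only [similarityTo, Function.comp, rotateScale_apply]
  rw [add_assoc]

theorem Template.volume_between (A : Template) (x y : Plane) :
    volume (A.between x y) = ENNReal.ofReal (‖y - x‖ ^ 2) * volume A.carrier := by
  rw [Template.between, similarityTo_eq, Set.image_comp, Set.image_add_left,
    measure_preimage_add, Measure.addHaar_image_linearMap, det_rotateScale,
    abs_of_nonneg (by positivity)]

theorem Template.volume_carrier_ne_top (A : Template) : volume A.carrier ≠ ∞ :=
  ((measure_mono (A.subset_lune.trans Set.inter_subset_left)).trans_lt
    Metric.isBounded_ball.measure_lt_top).ne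

theorem Template.volume_carrier_ne_zero (A : Template) : volume A.carrier ≠ 0 :=
  (A.isOpen.measure_pos _ ((⟨midpoint ℝ vMinus vPlus, A.segment_subset
    ⟨1 / 2, 1 / 2, by norm_num, by norm_num, by norm_num, by
      rw [midpoint_eq_smul_add, smul_add]; norm_num⟩⟩))).ne'

theorem Template.area_pos (A : Template) : 0 < A.area :=
  ENNReal.toReal_pos A.volume_carrier_ne_zero A.volume_carrier_ne_top

theorem Template.volume_between_eq_ofReal (A : Template) (x y : Plane) :
    volume (A.between x y) = ENNReal.ofReal (A.area * ‖y - x‖ ^ 2) := by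
  rw [A.volume_between, mul_comm A.area, ENNReal.ofReal_mul (by positivity), Template.area,
    ENNReal.ofReal_toReal A.volume_carrier_ne_top]

/-- The inverse of `similarityTo x y`. -/
def similarityInv (x y q : Plane) : Plane :=
  !₂[((q 0 - (x 0 + y 0) / 2) * (y 0 - x 0) + (q 1 - (x 1 + y 1) / 2) * (y 1 - x 1)) /
      ((y 0 - x 0) ^ 2 + (y 1 - x 1) ^ 2),
    ((q 1 - (x 1 + y 1) / 2) * (y 0 - x 0) - (q 0 - (x 0 + y 0) / 2) * (y 1 - x 1)) /
      ((y 0 - x 0) ^ 2 + (y 1 - x 1) ^ 2)]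

theorem Plane.sub_sq_add_sub_sq_ne_zero {x y : Plane} (h : x ≠ y) :
    (y 0 - x 0) ^ 2 + (y 1 - x 1) ^ 2 ≠ 0 := by
  have h1 := Plane.norm_sq (y - x)
  simp only [PiLp.sub_apply] at h1
  rw [← h1]
  exact pow_ne_zero _ (norm_ne_zero_iff.2 (sub_ne_zero.2 h.symm))

theorem similarityInv_similarityTo {x y : Plane} (h : x ≠ y) (p : Plane) :
    similarityInv x y (similarityTo x y p) = p := by
  have h1 := Plane.sub_sq_add_sub_sq_ne_zero h
  ext i
  fin_cases i <;> simp [similarityInv, similarityTo, midpoint_eq_smul_add] <;> field_simp <;> ring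

theorem similarityTo_similarityInv {x y : Plane} (h : x ≠ y) (q : Plane) :
    similarityTo x y (similarityInv x y q) = q := by
  have h1 := Plane.sub_sq_add_sub_sq_ne_zero h
  ext i
  fin_cases i <;> simp [similarityInv, similarityTo, midpoint_eq_smul_add] <;> field_simp <;> ring

theorem Template.mem_between_iff (A : Template) {x y : Plane} (h : x ≠ y) (q : Plane) :
    q ∈ A.between x y ↔ similarityInv x y q ∈ A.carrier := by
  constructor
  · rintro ⟨p, hp, rfl⟩
    rwa [similarityInv_similarityTo h]
  · exact fun hq => ⟨_, hq, similarityTo_similarityInv h q⟩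

/-- The distance from `vMinus` to `vPlus` is exactly 1 and the discs are open. This is what keeps
the endpoints `x`, `y` out of `A(x, y)`. -/
theorem vMinus_notMem_lune : vMinus ∉ lune := by
  intro h
  have h2 := h.2
  rw [Metric.mem_ball, EuclideanSpace.dist_eq] at h2
  simp [vMinus, vPlus, Real.dist_eq] at h2
  norm_num at h2

theorem Template.left_notMem_between (A : Template) {x y : Plane} (h : x ≠ y) :
    x ∉ A.between x y := by
  rw [A.mem_between_iff h]
  have h1 := similarityInv_similarityTo h vMinus
  rw [similarityTo_vMinus] at h1
  rw [h1]
  exact fun hm => vMinus_notMem_lune (A.subset_lune hm)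

theorem Template.right_notMem_between (A : Template) {x y : Plane} (h : x ≠ y) :
    y ∉ A.between x y := by
  rw [A.between_swap]
  exact A.left_notMem_between h.symm

/-- Openness jointly in `x`, `y` and the point: if `p ∈ A(x, y)`, then points near `p` stay in
`A(x', y')` for all nearby `x'`, `y'`. It holds because `similarityInv` is continuous off the
diagonal. -/
theorem Template.isOpen_setOf_mem_between (A : Template) :
    IsOpen {z : (Plane × Plane) × Plane | z.1.1 ≠ z.1.2 ∧ z.2 ∈ A.between z.1.1 z.1.2} := by
  have hU : IsOpen {z : (Plane × Plane) × Plane | z.1.1 ≠ z.1.2} :=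
    isOpen_ne_fun (by fun_prop) (by fun_prop)
  have hc : ContinuousOn (fun z : (Plane × Plane) × Plane => similarityInv z.1.1 z.1.2 z.2)
      {z : (Plane × Plane) × Plane | z.1.1 ≠ z.1.2} := by
    unfold similarityInv
    refine (PiLp.continuous_toLp 2 _).comp_continuousOn (continuousOn_pi.2 fun i => ?_)
    fin_cases i
    · exact ContinuousOn.div (by fun_prop) (by fun_prop)
        fun z hz => Plane.sub_sq_add_sub_sq_ne_zero hz
    · exact ContinuousOn.div (by fun_prop) (by fun_prop)
        fun z hz => Plane.sub_sq_add_sub_sq_ne_zero hz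
  convert hc.isOpen_inter_preimage hU A.isOpen using 1
  ext z
  simp only [Set.mem_ofPred_eq, Set.mem_inter_iff, Set.mem_preimage]
  exact and_congr_right fun h => A.mem_between_iff h _

theorem Template.isOpen_between (A : Template) {x y : Plane} (h : x ≠ y) :
    IsOpen (A.between x y) := by
  convert A.isOpen_setOf_mem_between.preimage
    (f := fun q : Plane => (((x, y), q) : (Plane × Plane) × Plane)) (by fun_prop) using 1
  ext q
  simp [h]

/-! ### Length of the part of a segment inside a set -/

theorem hausdorffMeasure_segment_inter (x y : Plane) (B : Set Plane) :
    Measure.hausdorffMeasure 1 (segment ℝ x y ∩ B) =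
      ‖y - x‖ₑ * volume (Set.Icc (0 : ℝ) 1 ∩ AffineMap.lineMap x y ⁻¹' B) := by
  rw [segment_eq_image_lineMap, ← Set.image_inter_preimage, hausdorffMeasure_lineMap_image,
    hausdorffMeasure_real, ENNReal.smul_def, smul_eq_mul, nndist_comm, nndist_eq_nnnorm]
  rfl

theorem volume_Icc_inter_lineMap {B : Set Plane} (hB : MeasurableSet B) (x y : Plane) :
    volume (Set.Icc (0 : ℝ) 1 ∩ AffineMap.lineMap x y ⁻¹' B) =
      ∫⁻ t in Set.Icc (0 : ℝ) 1, B.indicator 1 (x + t • (y - x)) := by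
  have hm : Measurable (AffineMap.lineMap x y : ℝ → Plane) :=
    (AffineMap.lineMap_continuous (R := ℝ)).measurable
  have h : (fun t : ℝ => (B.indicator 1 (x + t • (y - x)) : ℝ≥0∞)) =
      (AffineMap.lineMap x y ⁻¹' B : Set ℝ).indicator 1 := by
    funext t
    have h1 : AffineMap.lineMap x y t = x + t • (y - x) := by
      rw [AffineMap.lineMap_apply, vsub_eq_sub, vadd_eq_add, add_comm]
    rw [← h1]
    rfl
  rw [h, lintegral_indicator_one (hm hB), Measure.restrict_apply (hm hB), Set.inter_comm]

theorem measurable_volume_Icc_inter_lineMap {B : Set Plane} (hB : MeasurableSet B) :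
    Measurable fun z : Plane × Plane =>
      volume (Set.Icc (0 : ℝ) 1 ∩ AffineMap.lineMap z.1 z.2 ⁻¹' B) := by
  simp_rw [volume_Icc_inter_lineMap hB]
  refine Measurable.lintegral_prod_right' (f := fun w : (Plane × Plane) × ℝ =>
    (B.indicator 1 (w.1.1 + w.2 • (w.1.2 - w.1.1)) : ℝ≥0∞)) ?_
  exact (measurable_one.indicator hB).comp (by fun_prop)

theorem measurable_hausdorffMeasure_segment_inter {B : Set Plane} (hB : MeasurableSet B) :
    Measurable fun z : Plane × Plane =>
      (Measure.hausdorffMeasure 1 (segment ℝ z.1 z.2 ∩ B) : ℝ≥0∞) := by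
  simp_rw [hausdorffMeasure_segment_inter]
  exact Measurable.mul (by fun_prop) (measurable_volume_Icc_inter_lineMap hB)

/-- Substitute `z = y - x` and integrate over `x` first: for fixed `z` and `t`, the point `x + t •
z` is a translate of `x`, so it contributes `volume B` whatever `t ∈ [0, 1]` is. -/
theorem lintegral_mul_volume_Icc_inter_lineMap {B : Set Plane} (hB : MeasurableSet B)
    {g : Plane → ℝ≥0∞} (hg : Measurable g) :
    ∫⁻ x : Plane, ∫⁻ y : Plane,
        g (y - x) * volume (Set.Icc (0 : ℝ) 1 ∩ AffineMap.lineMap x y ⁻¹' B) =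
      (∫⁻ z, g z) * volume B := by
  have hB1 : Measurable (B.indicator (1 : Plane → ℝ≥0∞)) := measurable_one.indicator hB
  simp_rw [volume_Icc_inter_lineMap hB]
  have h1 (x : Plane) : ∫⁻ y : Plane,
        g (y - x) * ∫⁻ t in Set.Icc (0 : ℝ) 1, B.indicator 1 (x + t • (y - x)) =
      ∫⁻ z : Plane, g z * ∫⁻ t in Set.Icc (0 : ℝ) 1, B.indicator 1 (x + t • z) :=
    lintegral_sub_right_eq_self
      (fun z => g z * ∫⁻ t in Set.Icc (0 : ℝ) 1, B.indicator 1 (x + t • z)) x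
  simp_rw [h1]
  have h2 : Measurable fun w : Plane × Plane =>
      ∫⁻ t in Set.Icc (0 : ℝ) 1, B.indicator (1 : Plane → ℝ≥0∞) (w.1 + t • w.2) :=
    Measurable.lintegral_prod_right' (f := fun w : (Plane × Plane) × ℝ =>
      (B.indicator 1 (w.1.1 + w.2 • w.1.2) : ℝ≥0∞)) (hB1.comp (by fun_prop))
  rw [lintegral_lintegral_swap (by
    exact ((hg.comp measurable_snd).mul h2).aemeasurable), ← lintegral_mul_const _ hg]
  refine lintegral_congr fun z => ?_
  rw [lintegral_const_mul (f := fun x => ∫⁻ t in Set.Icc (0 : ℝ) 1, B.indicator 1 (x + t • z)) _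
      (h2.comp (measurable_id.prodMk measurable_const)),
    lintegral_lintegral_swap (by
      exact (hB1.comp (by fun_prop : Measurable fun w : Plane × ℝ => w.1 + w.2 • z)).aemeasurable)]
  congr 1
  have h3 (t : ℝ) : ∫⁻ x : Plane, B.indicator (1 : Plane → ℝ≥0∞) (x + t • z) = volume B := by
    rw [lintegral_add_right_eq_self (B.indicator (1 : Plane → ℝ≥0∞)) (t • z),
      lintegral_indicator_one hB]
  simp_rw [h3]
  simp

/-! ### Gaussian integrals in the plane -/

theorem lintegral_plane_rpow_mul_exp {q c : ℝ} (hq : 0 ≤ q) (hc : 0 < c) :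
    ∫⁻ z : Plane, ENNReal.ofReal (‖z‖ ^ q * Real.exp (-(c * ‖z‖ ^ 2))) =
      ENNReal.ofReal (Real.pi * c ^ (-(q + 2) / 2) * Real.Gamma ((q + 2) / 2)) := by
  have hmp := Complex.orthonormalBasisOneI.repr.measurePreserving
  have h1 := Complex.integral_rpow_mul_exp_neg_mul_rpow (p := 2) (q := q) (b := c)
    (by norm_num) (by linarith) hc
  have hpos : 0 < Real.pi * c ^ (-(q + 2) / 2) * Real.Gamma ((q + 2) / 2) :=
    mul_pos (mul_pos Real.pi_pos (Real.rpow_pos_of_pos hc _)) (Real.Gamma_pos_of_pos (by linarith))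
  have h2 : ∫ x : ℂ, ‖x‖ ^ q * Real.exp (-c * ‖x‖ ^ (2 : ℝ)) =
      Real.pi * c ^ (-(q + 2) / 2) * Real.Gamma ((q + 2) / 2) := by
    rw [h1]; ring
  -- The integral of a non-integrable function is 0 by convention, so a nonzero value forces
  -- integrability.
  have hint : Integrable fun x : ℂ => ‖x‖ ^ q * Real.exp (-c * ‖x‖ ^ (2 : ℝ)) :=
    Integrable.of_integral_ne_zero (by rw [h2]; exact hpos.ne')
  rw [← hmp.lintegral_comp (by fun_prop), ← h2,
    ofReal_integral_eq_lintegral_ofReal hint (Filter.Eventually.of_forall fun x => by positivity)]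
  refine lintegral_congr fun x => ?_
  rw [LinearIsometryEquiv.norm_map, Real.rpow_two, neg_mul]

theorem lintegral_plane_exp {c : ℝ} (hc : 0 < c) :
    ∫⁻ z : Plane, ENNReal.ofReal (Real.exp (-(c * ‖z‖ ^ 2))) = ENNReal.ofReal (Real.pi / c) := by
  have h := lintegral_plane_rpow_mul_exp le_rfl hc
  simp only [Real.rpow_zero, one_mul] at h
  rw [h]
  norm_num [Real.rpow_neg_one, div_eq_mul_inv]

/-- The factor 2 is split off because ordered pairs count every edge twice. -/
theorem lintegral_plane_norm_mul_exp {c : ℝ} (hc : 0 < c) :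
    ∫⁻ z : Plane, ‖z‖ₑ * ENNReal.ofReal (Real.exp (-(c * ‖z‖ ^ 2))) =
      2 * ENNReal.ofReal (Real.pi ^ (3 / 2 : ℝ) / (4 * c ^ (3 / 2 : ℝ))) := by
  have h := lintegral_plane_rpow_mul_exp zero_le_one hc
  simp only [Real.rpow_one] at h
  have h3 : Real.Gamma ((1 + 2) / 2) = Real.sqrt Real.pi / 2 := by
    rw [show ((1 + 2) / 2 : ℝ) = 1 / 2 + 1 by norm_num, Real.Gamma_add_one (by norm_num),
      Real.Gamma_one_half_eq]
    ring
  have h4 : (2 : ℝ≥0∞) = ENNReal.ofReal 2 := (ENNReal.ofReal_ofNat 2).symm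
  conv_rhs => rw [h4, ← ENNReal.ofReal_mul (by norm_num)]
  convert h using 2
  · funext z
    rw [ENNReal.ofReal_mul (norm_nonneg _), ofReal_norm]
  · rw [h3, show (-(1 + 2) / 2 : ℝ) = -(3 / 2) by norm_num, Real.rpow_neg hc.le,
      show (3 / 2 : ℝ) = 1 + 1 / 2 by norm_num, Real.rpow_add Real.pi_pos, Real.rpow_one,
      ← Real.sqrt_eq_rpow]
    field_simp
    ring

/-! ### Shrinking finite partitions -/

/-- `q n x` records which of the first `n` members of a countable basis contain `x`. Points with the
same record as `x` lie in any given basic neighbourhood of `x` once its index is below `n`. -/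
theorem exists_shrinking_partitions (α : Type*) [TopologicalSpace α] [SecondCountableTopology α]
    [MeasurableSpace α] [OpensMeasurableSpace α] [Nonempty α] :
    ∃ q : (n : ℕ) → α → (Fin n → Prop), (∀ n, Measurable (q n)) ∧
      ∀ x, ∀ U ∈ nhds x, ∀ᶠ n in Filter.atTop, ∀ x', q n x' = q n x → x' ∈ U := by
  have hb := TopologicalSpace.isBasis_countableBasis α
  have hne : (TopologicalSpace.countableBasis α).Nonempty := by
    obtain ⟨v, hv, -, -⟩ := hb.exists_subset_of_mem_open
      (Set.mem_univ (Classical.arbitrary α)) isOpen_univ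
    exact ⟨v, hv⟩
  obtain ⟨b, hbr⟩ := (TopologicalSpace.countable_countableBasis α).exists_eq_range hne
  refine ⟨fun n x k => x ∈ b k, fun n => measurable_pi_iff.2 fun k => ?_, fun x U hU => ?_⟩
  · have : IsOpen (b k) := hb.isOpen (hbr ▸ Set.mem_range_self _)
    exact measurable_mem.2 this.measurableSet
  · obtain ⟨v, hv, hxv, hvU⟩ := hb.mem_nhds_iff.1 hU
    rw [hbr] at hv
    obtain ⟨k, rfl⟩ := hv
    filter_upwards [Filter.eventually_gt_atTop k] with n hn x' hx'
    have := congrFun hx' ⟨k, hn⟩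
    exact hvU (this.symm ▸ hxv)

theorem lintegral_prod_comp_fintype {α ι : Type*} [MeasurableSpace α] [MeasurableSpace ι]
    [Fintype ι] [MeasurableSingletonClass ι] {q : α → ι} (hq : Measurable q) (μ ν : Measure α)
    [IsFiniteMeasure μ] [IsFiniteMeasure ν] (g : ι → ι → ℝ≥0∞) :
    ∫⁻ z, g (q z.1) (q z.2) ∂(μ.prod ν) =
      ∑ s, ∑ t, μ (q ⁻¹' {s}) * ν (q ⁻¹' {t}) * g s t := by
  have h1 : ∫⁻ z, g (q z.1) (q z.2) ∂(μ.prod ν) =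
      ∫⁻ w, g w.1 w.2 ∂((μ.map q).prod (ν.map q)) := by
    rw [Measure.map_prod_map _ _ hq hq, lintegral_map (.of_discrete) (hq.prodMap hq)]
    rfl
  rw [h1, lintegral_fintype, Fintype.sum_prod_type]
  refine Finset.sum_congr rfl fun s _ => Finset.sum_congr rfl fun t _ => ?_
  rw [← Set.singleton_prod_singleton, Measure.prod_prod,
    Measure.map_apply hq (measurableSet_singleton _),
    Measure.map_apply hq (measurableSet_singleton _), mul_comm]

/-- The interior of the intersection of the sets `A(x, y)` with `x ∈ C` and `y ∈ D`. -/
def Template.innerBetween (A : Template) (C D : Set Plane) : Set Plane :=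
  interior {p | ∀ x ∈ C, ∀ y ∈ D, p ∈ A.between x y}

theorem Template.innerBetween_subset (A : Template) {C D : Set Plane} {x y : Plane} (hx : x ∈ C)
    (hy : y ∈ D) : A.innerBetween C D ⊆ A.between x y :=
  fun _ hp => interior_subset hp x hx y hy

theorem Template.measurableSet_innerBetween (A : Template) (C D : Set Plane) :
    MeasurableSet (A.innerBetween C D) :=
  isOpen_interior.measurableSet

/-- A point `x` of `C` is outside `A(x, y)` for every `y ∈ D`. Nonemptiness matters: if `C` or `D`
were empty, the inner set would be the whole plane. -/
theorem Template.disjoint_innerBetween (A : Template) {C D : Set Plane} (hCD : Disjoint C D)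
    (hC : C.Nonempty) (hD : D.Nonempty) :
    Disjoint C (A.innerBetween C D) ∧ Disjoint D (A.innerBetween C D) := by
  obtain ⟨x, hx⟩ := hC
  obtain ⟨y, hy⟩ := hD
  constructor
  · exact Set.disjoint_left.2 fun x hx hp =>
      A.left_notMem_between (hCD.ne_of_mem hx hy) (A.innerBetween_subset hx hy hp)
  · exact Set.disjoint_left.2 fun y hy hp =>
      A.right_notMem_between (hCD.ne_of_mem hx hy) (A.innerBetween_subset hx hy hp)

/-- Joint openness gives a product neighbourhood of `((x, y), p)`; the cells of `x` and `y`
eventually fit into its first two factors, and the third is then a neighbourhood of `p` inside the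
intersection. -/
theorem Template.eventually_mem_innerBetween (A : Template) {q : (n : ℕ) → Plane → (Fin n → Prop)}
    (hq : ∀ x, ∀ U ∈ nhds x, ∀ᶠ n in Filter.atTop, ∀ x', q n x' = q n x → x' ∈ U)
    (C D : Set Plane) {x y : Plane} (hxy : x ≠ y) {p : Plane} (hp : p ∈ A.between x y) :
    ∀ᶠ n in Filter.atTop,
      p ∈ A.innerBetween (C ∩ q n ⁻¹' {q n x}) (D ∩ q n ⁻¹' {q n y}) := by
  have h1 : {z : (Plane × Plane) × Plane | z.1.1 ≠ z.1.2 ∧ z.2 ∈ A.between z.1.1 z.1.2} ∈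
      nhds ((x, y), p) := A.isOpen_setOf_mem_between.mem_nhds ⟨hxy, hp⟩
  rw [nhds_prod_eq, Filter.mem_prod_iff] at h1
  obtain ⟨U, hU, W, hW, hUW⟩ := h1
  rw [nhds_prod_eq, Filter.mem_prod_iff] at hU
  obtain ⟨U₁, hU₁, U₂, hU₂, hU⟩ := hU
  filter_upwards [hq x U₁ hU₁, hq y U₂ hU₂] with n h1 h2
  refine mem_interior_iff_mem_nhds.2 (Filter.mem_of_superset hW fun p' hp' x' hx' y' hy' => ?_)
  exact (@hUW ((x', y'), p') ⟨hU ⟨h1 x' hx'.2, h2 y' hy'.2⟩, hp'⟩).2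

/-! ### The counting measure of a set -/

/-- The counting measure of a set: the sum of the Dirac masses at its points. -/
def countOn {α : Type*} [MeasurableSpace α] (S : Set α) : Measure α :=
  Measure.sum fun x : S => Measure.dirac (x : α)

theorem countOn_apply {α : Type*} [MeasurableSpace α] (S : Set α) {s : Set α}
    (hs : MeasurableSet s) : countOn S s = ((S ∩ s).encard : ℝ≥0∞) := by
  rw [countOn, Measure.sum_apply _ hs, ← ENNReal.tsum_set_one,
    tsum_subtype (S ∩ s) (fun _ => (1 : ℝ≥0∞)), ← Set.indicator_indicator,
    ← tsum_subtype S (s.indicator fun _ => (1 : ℝ≥0∞))]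
  exact tsum_congr fun x => Measure.dirac_apply' _ hs

theorem countOn_singleton {α : Type*} [MeasurableSpace α] [MeasurableSingletonClass α] {S : Set α}
    {x : α} (hx : x ∈ S) : countOn S {x} = 1 := by
  rw [countOn_apply S (measurableSet_singleton x),
    Set.inter_eq_self_of_subset_right (Set.singleton_subset_iff.2 hx)]
  simp

theorem sFinite_countOn {α : Type*} [MeasurableSpace α] {S : Set α} (hS : S.Countable) :
    SFinite (countOn S) := by
  have := hS.to_subtype
  unfold countOn
  infer_instance

theorem ae_countOn_mem {α : Type*} [MeasurableSpace α] [MeasurableSingletonClass α] {S : Set α}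
    (hS : S.Countable) : ∀ᵐ x ∂(countOn S), x ∈ S := by
  rw [ae_iff]
  change countOn S Sᶜ = 0
  rw [countOn_apply S hS.measurableSet.compl]
  simp

/-! ### Moments and void probabilities of the Poisson process -/

theorem lintegral_poissonMeasure (r : ℝ≥0) (f : ℕ → ℝ≥0∞) :
    ∫⁻ n, f n ∂(poissonMeasure r) =
      ∑' n : ℕ, ENNReal.ofReal (Real.exp (-r) * r ^ n / n.factorial) * f n := by
  rw [poissonMeasure, lintegral_sum_measure]
  exact tsum_congr fun n => by rw [lintegral_smul_measure, lintegral_dirac, smul_eq_mul]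

theorem lintegral_cast_poissonMeasure (r : ℝ≥0) :
    ∫⁻ n : ℕ, (n : ℝ≥0∞) ∂(poissonMeasure r) = r := by
  have h1 : ∑' n : ℕ, ENNReal.ofReal (Real.exp (-r) * r ^ n / n.factorial) = 1 := by
    have := lintegral_poissonMeasure r fun _ => 1
    simpa using this.symm
  rw [lintegral_poissonMeasure, tsum_eq_zero_add' ENNReal.summable]
  have h2 (n : ℕ) : ENNReal.ofReal (Real.exp (-r) * r ^ (n + 1) / (n + 1).factorial) *
      ((n + 1 : ℕ) : ℝ≥0∞) = r * ENNReal.ofReal (Real.exp (-r) * r ^ n / n.factorial) := by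
    rw [← ENNReal.ofReal_natCast (n + 1), ← ENNReal.ofReal_mul (by positivity),
      ← ENNReal.ofReal_coe_nnreal (p := r), ← ENNReal.ofReal_mul (by positivity)]
    congr 1
    rw [Nat.factorial_succ]
    push_cast
    have : (n : ℝ) + 1 ≠ 0 := by positivity
    field_simp
    ring
  simp_rw [h2, ENNReal.tsum_mul_left, h1]
  simp

/-- The indicator of the value `0`. -/
def zeroIndicator (n : ℕ∞) : ℝ≥0∞ := if n = 0 then 1 else 0

theorem zeroIndicator_le_one (n : ℕ∞) : zeroIndicator n ≤ 1 := by
  unfold zeroIndicator; split_ifs <;> simp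

theorem lintegral_zeroIndicator_poissonMeasure (r : ℝ≥0) :
    ∫⁻ n : ℕ, zeroIndicator n ∂(poissonMeasure r) = ENNReal.ofReal (Real.exp (-r)) := by
  rw [lintegral_poissonMeasure, tsum_eq_single 0]
  · simp [zeroIndicator]
  · intro n hn
    simp [zeroIndicator, hn]

namespace IsPoissonProcess

variable {Ω : Type*} [MeasurableSpace Ω] {P : Measure Ω} {X : Ω → Set Plane}

theorem countable (hX : IsPoissonProcess X P) (ω : Ω) : (X ω).Countable := by
  have h : X ω = ⋃ n : ℕ, X ω ∩ Metric.ball 0 n := by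
    rw [← Set.inter_iUnion, Metric.iUnion_ball_nat, Set.inter_univ]
  rw [h]
  exact Set.countable_iUnion fun n => (hX.locallyFinite ω _ Metric.isBounded_ball).countable

theorem lintegral_comp_count (hX : IsPoissonProcess X P) {B : Set Plane} (hB : MeasurableSet B)
    (hB' : volume B ≠ ∞) (f : ℕ∞ → ℝ≥0∞) :
    ∫⁻ ω, f (X ω ∩ B).encard ∂P =
      ∫⁻ n : ℕ, f n ∂(poissonMeasure (volume B).toNNReal) := by
  rw [← lintegral_map (f := f) .of_discrete (hX.measurable_count B hB), hX.law_count B hB hB',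
    lintegral_map .of_discrete .of_discrete]

theorem lintegral_count (hX : IsPoissonProcess X P) {B : Set Plane} (hB : MeasurableSet B)
    (hB' : volume B ≠ ∞) : ∫⁻ ω, ((X ω ∩ B).encard : ℝ≥0∞) ∂P = volume B := by
  rw [hX.lintegral_comp_count hB hB' fun n => (n : ℝ≥0∞)]
  simp only [ENat.toENNReal_coe]
  rw [lintegral_cast_poissonMeasure, ENNReal.coe_toNNReal hB']

theorem lintegral_zeroIndicator (hX : IsPoissonProcess X P) {B : Set Plane} (hB : MeasurableSet B)
    (hB' : volume B ≠ ∞) : ∫⁻ ω, zeroIndicator (X ω ∩ B).encard ∂P =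
      ENNReal.ofReal (Real.exp (-(volume B).toReal)) := by
  rw [hX.lintegral_comp_count hB hB', lintegral_zeroIndicator_poissonMeasure]
  rfl

/-- The only place where independence of the counts enters. -/
theorem lintegral_count_mul_count_mul_zeroIndicator (hX : IsPoissonProcess X P)
    {C D V : Set Plane} (hC : MeasurableSet C) (hD : MeasurableSet D) (hV : MeasurableSet V)
    (hC' : volume C ≠ ∞) (hD' : volume D ≠ ∞) (hV' : volume V ≠ ∞) (hCD : Disjoint C D)
    (hCV : Disjoint C V) (hDV : Disjoint D V) :
    ∫⁻ ω, (X ω ∩ C).encard * (X ω ∩ D).encard * zeroIndicator (X ω ∩ V).encard ∂P =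
      volume C * volume D * ENNReal.ofReal (Real.exp (-(volume V).toReal)) := by
  have hm : ∀ i, MeasurableSet (![C, D, V] i) := by
    intro i; fin_cases i <;> simpa
  have hi := hX.indep_count 3 ![C, D, V] hm (by
    intro i j hij
    fin_cases i <;> fin_cases j <;>
      simp_all [Function.onFun, disjoint_comm])
  let g : Fin 3 → ℕ∞ → ℝ≥0∞ := ![fun n => n, fun n => n, zeroIndicator]
  have h1 := lintegral_prod_eq_prod_lintegral_of_indepFun Finset.univ _
    (hi.comp g fun _ => .of_discrete)
    fun i => (Measurable.of_discrete (f := g i)).comp (hX.measurable_count _ (hm i))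
  simp only [Fin.prod_univ_three, Function.comp_apply] at h1
  rw [← hX.lintegral_count hC hC', ← hX.lintegral_count hD hD', ← hX.lintegral_zeroIndicator hV hV']
  exact h1

end IsPoissonProcess

/-! ### The pairs of adjacent vertices -/

/-- The set of ordered pairs of adjacent vertices of the proximity graph on `S`. -/
def edgePairs (A : Template) (S : Set Plane) : Set (Plane × Plane) :=
  {z | z.1 ∈ S ∧ z.2 ∈ S ∧ z.1 ≠ z.2 ∧ A.between z.1 z.2 ∩ S = ∅}

theorem countable_edgePairs (A : Template) {S : Set Plane} (hS : S.Countable) :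
    (edgePairs A S).Countable :=
  (hS.prod hS).mono (show edgePairs A S ⊆ S ×ˢ S from fun _ hz => ⟨hz.1, hz.2.1⟩)

/-- The counting measure of the set of ordered pairs of adjacent vertices. -/
def pairMeasure (A : Template) (S : Set Plane) : Measure (Plane × Plane) :=
  ((countOn S).prod (countOn S)).restrict (edgePairs A S)

theorem lintegral_pairMeasure (A : Template) {S : Set Plane} (hS : S.Countable)
    (f : Plane × Plane → ℝ≥0∞) :
    ∫⁻ z, f z ∂(pairMeasure A S) = ∑' z : edgePairs A S, f z := by
  have := sFinite_countOn hS
  rw [pairMeasure, lintegral_countable _ (countable_edgePairs A hS)]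
  refine tsum_congr fun z => ?_
  obtain ⟨⟨x, y⟩, hx, hy, -⟩ := z
  rw [← Set.singleton_prod_singleton, Measure.prod_prod, countOn_singleton hx,
    countOn_singleton hy, one_mul, mul_one]

theorem ae_pairMeasure_fst_ne_snd (A : Template) {S : Set Plane} (hS : S.Countable) :
    ∀ᵐ z ∂(pairMeasure A S), z.1 ≠ z.2 := by
  filter_upwards [ae_restrict_mem (countable_edgePairs A hS).measurableSet] with z hz
  exact hz.2.2.1

/-- The inner set of the parts of `C` and `D` in the cells of `q` with the indices `s` and `t`. -/
def cellBetween (A : Template) (C D : Set Plane) {ι : Type*} (q : Plane → ι) (s t : ι) :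
    Set Plane :=
  A.innerBetween (C ∩ q ⁻¹' {s}) (D ∩ q ⁻¹' {t})

/-- The sum over pairs of cells of the product of their masses and `Φ` of the inner set. -/
def cellSum (A : Template) (C D : Set Plane) {ι : Type*} [Fintype ι] (q : Plane → ι)
    (μ : Measure Plane) (Φ : Set Plane → ℝ≥0∞) : ℝ≥0∞ :=
  ∑ s, ∑ t, μ (C ∩ q ⁻¹' {s}) * μ (D ∩ q ⁻¹' {t}) * Φ (cellBetween A C D q s t)

/-! ### Limits of cell sums as the cells shrink -/

section Cells

variable {A : Template} {C D : Set Plane}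

/-- Seen as the integral of a step function against a fixed product measure, the cell sum becomes
accessible to dominated convergence. -/
theorem cellSum_eq_lintegral {ι : Type*} [Fintype ι] [MeasurableSpace ι]
    [MeasurableSingletonClass ι] {q : Plane → ι} (hq : Measurable q) (hC : MeasurableSet C)
    (hD : MeasurableSet D) {μ : Measure Plane} (hμC : μ C ≠ ∞) (hμD : μ D ≠ ∞)
    (Φ : Set Plane → ℝ≥0∞) :
    cellSum A C D q μ Φ = ∫⁻ z, Φ (cellBetween A C D q (q z.1) (q z.2))
      ∂((μ.restrict C).prod (μ.restrict D)) := by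
  have : IsFiniteMeasure (μ.restrict C) := ⟨by simpa using hμC.lt_top⟩
  have : IsFiniteMeasure (μ.restrict D) := ⟨by simpa using hμD.lt_top⟩
  rw [lintegral_prod_comp_fintype hq _ _ fun s t => Φ (cellBetween A C D q s t)]
  refine Finset.sum_congr rfl fun s _ => Finset.sum_congr rfl fun t _ => ?_
  rw [Measure.restrict_apply' hC, Measure.restrict_apply' hD, Set.inter_comm C, Set.inter_comm D]

theorem cellSum_le {ι : Type*} [Fintype ι] [MeasurableSpace ι]
    [MeasurableSingletonClass ι] {q : Plane → ι} (hq : Measurable q) (hC : MeasurableSet C)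
    (hD : MeasurableSet D) {μ : Measure Plane} (hμC : μ C ≠ ∞) (hμD : μ D ≠ ∞)
    {Φ : Set Plane → ℝ≥0∞} (hΦ : ∀ V, Φ V ≤ 1) :
    cellSum A C D q μ Φ ≤ μ C * μ D := by
  have : IsFiniteMeasure (μ.restrict C) := ⟨by simpa using hμC.lt_top⟩
  have : IsFiniteMeasure (μ.restrict D) := ⟨by simpa using hμD.lt_top⟩
  rw [cellSum_eq_lintegral hq hC hD hμC hμD]
  calc _ ≤ ∫⁻ _, 1 ∂((μ.restrict C).prod (μ.restrict D)) := lintegral_mono fun _ => hΦ _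
    _ = μ C * μ D := by
      rw [lintegral_one, ← Set.univ_prod_univ, Measure.prod_prod]; simp

theorem tendsto_cellSum {q : (n : ℕ) → Plane → (Fin n → Prop)} (hq : ∀ n, Measurable (q n))
    (hC : MeasurableSet C) (hD : MeasurableSet D) {μ : Measure Plane}
    (hμC : μ C ≠ ∞) (hμD : μ D ≠ ∞) {Φ : Set Plane → ℝ≥0∞} (hΦ : ∀ V, Φ V ≤ 1)
    {F : Plane × Plane → ℝ≥0∞}
    (hF : ∀ᵐ z ∂((μ.restrict C).prod (μ.restrict D)), Filter.Tendsto
      (fun n => Φ (cellBetween A C D (q n) (q n z.1) (q n z.2))) Filter.atTop (nhds (F z))) :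
    Filter.Tendsto (fun n => cellSum A C D (q n) μ Φ) Filter.atTop
      (nhds (∫⁻ z, F z ∂((μ.restrict C).prod (μ.restrict D)))) := by
  have : IsFiniteMeasure (μ.restrict C) := ⟨by simpa using hμC.lt_top⟩
  have : IsFiniteMeasure (μ.restrict D) := ⟨by simpa using hμD.lt_top⟩
  simp_rw [fun n => cellSum_eq_lintegral (A := A) (hq n) hC hD hμC hμD Φ]
  refine tendsto_lintegral_of_dominated_convergence' (fun _ => 1) (fun n => ?_)
    (fun n => Filter.Eventually.of_forall fun _ => hΦ _) ?_ hF
  · have : Measurable fun w : (Fin n → Prop) × (Fin n → Prop) =>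
        Φ (cellBetween A C D (q n) w.1 w.2) := .of_discrete
    exact (this.comp ((hq n).prodMap (hq n))).aemeasurable
  · rw [lintegral_one]
    exact measure_ne_top _ _

theorem ae_restrict_prod_restrict_mem {μ : Measure Plane} (hC : MeasurableSet C)
    (hD : MeasurableSet D) :
    ∀ᵐ z ∂((μ.restrict C).prod (μ.restrict D)), z.1 ∈ C ∧ z.2 ∈ D :=
  (Measure.quasiMeasurePreserving_fst.ae (ae_restrict_mem hC)).and
    (Measure.quasiMeasurePreserving_snd.ae (ae_restrict_mem hD))

/-- The integrand is eventually constant at each pair of vertices. If `A(x, y)` is void, so are the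
inner sets, being subsets; if it contains a vertex, that vertex eventually lies in the inner set. -/
theorem tendsto_cellSum_countOn {q : (n : ℕ) → Plane → (Fin n → Prop)}
    (hq : ∀ n, Measurable (q n))
    (hq' : ∀ x, ∀ U ∈ nhds x, ∀ᶠ n in Filter.atTop, ∀ x', q n x' = q n x → x' ∈ U)
    (hC : MeasurableSet C) (hD : MeasurableSet D) (hCD : Disjoint C D) {S : Set Plane}
    (hS : S.Countable) (hSC : countOn S C ≠ ∞) (hSD : countOn S D ≠ ∞) :
    Filter.Tendsto (fun n => cellSum A C D (q n) (countOn S)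
      fun V => zeroIndicator (S ∩ V).encard) Filter.atTop (nhds (pairMeasure A S (C ×ˢ D))) := by
  have := sFinite_countOn hS
  have hE := (countable_edgePairs A hS).measurableSet
  have h1 : pairMeasure A S (C ×ˢ D) = ∫⁻ z, (edgePairs A S).indicator 1 z
      ∂(((countOn S).restrict C).prod ((countOn S).restrict D)) := by
    rw [lintegral_indicator_one hE, Measure.prod_restrict, pairMeasure,
      Measure.restrict_apply (hC.prod hD), Measure.restrict_apply hE, Set.inter_comm]
  rw [h1]
  refine tendsto_cellSum hq hC hD hSC hSD (fun V => zeroIndicator_le_one _) ?_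
  filter_upwards [ae_restrict_prod_restrict_mem hC hD,
    Measure.quasiMeasurePreserving_fst.ae (ae_restrict_of_ae (ae_countOn_mem hS)),
    Measure.quasiMeasurePreserving_snd.ae (ae_restrict_of_ae (ae_countOn_mem hS))]
    with z hz hz1 hz2
  have hne : z.1 ≠ z.2 := hCD.ne_of_mem hz.1 hz.2
  refine tendsto_const_nhds.congr' ?_
  by_cases h : A.between z.1 z.2 ∩ S = ∅
  · refine Filter.Eventually.of_forall fun n => ?_
    have hsub : cellBetween A C D (q n) (q n z.1) (q n z.2) ⊆ A.between z.1 z.2 :=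
      A.innerBetween_subset ⟨hz.1, rfl⟩ ⟨hz.2, rfl⟩
    have h0 : S ∩ cellBetween A C D (q n) (q n z.1) (q n z.2) = ∅ :=
      Set.subset_eq_empty (show _ ⊆ A.between z.1 z.2 ∩ S from fun p hp => ⟨hsub hp.2, hp.1⟩) h
    rw [Set.indicator_of_mem (show z ∈ edgePairs A S from ⟨hz1, hz2, hne, h⟩)]
    simp [zeroIndicator, h0]
  · obtain ⟨p, hp, hpS⟩ := Set.nonempty_iff_ne_empty.2 h
    filter_upwards [A.eventually_mem_innerBetween hq' C D hne hp] with n hn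
    have h0 : (S ∩ cellBetween A C D (q n) (q n z.1) (q n z.2)).Nonempty := ⟨p, hpS, hn⟩
    rw [Set.indicator_of_notMem fun hz' => h hz'.2.2.2]
    exact (if_neg (Set.encard_ne_zero.2 h0)).symm

/-- The inner sets lie in `A(x, y)` and eventually contain each of its points, so their areas
converge to its finite area. -/
theorem tendsto_cellSum_volume {q : (n : ℕ) → Plane → (Fin n → Prop)}
    (hq : ∀ n, Measurable (q n))
    (hq' : ∀ x, ∀ U ∈ nhds x, ∀ᶠ n in Filter.atTop, ∀ x', q n x' = q n x → x' ∈ U)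
    (hC : MeasurableSet C) (hD : MeasurableSet D) (hCD : Disjoint C D)
    (hC' : volume C ≠ ∞) (hD' : volume D ≠ ∞) :
    Filter.Tendsto (fun n => cellSum A C D (q n) volume
      fun V => ENNReal.ofReal (Real.exp (-(volume V).toReal))) Filter.atTop
      (nhds (∫⁻ z in C ×ˢ D, ENNReal.ofReal (Real.exp (-(A.area * ‖z.2 - z.1‖ ^ 2))))) := by
  rw [Measure.volume_eq_prod, ← Measure.prod_restrict]
  refine tendsto_cellSum hq hC hD hC' hD' (fun V => by
    rw [← ENNReal.ofReal_one]
    exact ENNReal.ofReal_le_ofReal (Real.exp_le_one_iff.2 (by simp))) ?_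
  filter_upwards [ae_restrict_prod_restrict_mem hC hD] with z hz
  have hne : z.1 ≠ z.2 := hCD.ne_of_mem hz.1 hz.2
  have hsub (n : ℕ) : cellBetween A C D (q n) (q n z.1) (q n z.2) ⊆ A.between z.1 z.2 :=
    A.innerBetween_subset ⟨hz.1, rfl⟩ ⟨hz.2, rfl⟩
  have hfin : volume (A.between z.1 z.2) ≠ ∞ := by
    rw [A.volume_between_eq_ofReal]; exact ENNReal.ofReal_ne_top
  have h1 : Filter.Tendsto
      (fun n => volume (cellBetween A C D (q n) (q n z.1) (q n z.2))) Filter.atTop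
      (nhds (volume (A.between z.1 z.2))) := by
    refine tendsto_measure_of_tendsto_indicator _ (fun n => A.measurableSet_innerBetween _ _)
      (A.isOpen_between hne).measurableSet hfin (Filter.Eventually.of_forall hsub) fun p => ?_
    by_cases hp : p ∈ A.between z.1 z.2
    · filter_upwards [A.eventually_mem_innerBetween hq' C D hne hp] with n hn
      exact iff_of_true hn hp
    · exact Filter.Eventually.of_forall fun n => iff_of_false (fun h => hp (hsub n h)) hp
  have h2 := (ENNReal.tendsto_toReal hfin).comp h1
  rw [A.volume_between_eq_ofReal, ENNReal.toReal_ofReal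
    (mul_nonneg A.area_pos.le (by positivity))] at h2
  exact (ENNReal.continuous_ofReal.comp (Real.continuous_exp.comp continuous_neg)).tendsto _
    |>.comp h2

end Cells

/-! ### Mean number of adjacent pairs in a product of disjoint bounded sets -/

namespace IsPoissonProcess

variable {Ω : Type*} [MeasurableSpace Ω] {P : Measure Ω} {X : Ω → Set Plane}
  {A : Template} {C D : Set Plane}

theorem measurable_countOn (hX : IsPoissonProcess X P) (hC : MeasurableSet C) :
    Measurable fun ω => countOn (X ω) C := by
  simp_rw [countOn_apply _ hC]
  exact (Measurable.of_discrete (f := ENat.toENNReal)).comp (hX.measurable_count C hC)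

theorem measurable_cellSum (hX : IsPoissonProcess X P) {ι : Type*} [Fintype ι]
    [MeasurableSpace ι] [MeasurableSingletonClass ι] {q : Plane → ι} (hq : Measurable q)
    (hC : MeasurableSet C) (hD : MeasurableSet D) :
    Measurable fun ω => cellSum A C D q (countOn (X ω))
      fun V => zeroIndicator (X ω ∩ V).encard := by
  refine Finset.measurable_sum _ fun s _ => Finset.measurable_sum _ fun t _ => ?_
  exact ((hX.measurable_countOn (hC.inter (hq (measurableSet_singleton s)))).mul
    (hX.measurable_countOn (hD.inter (hq (measurableSet_singleton t))))).mul
    ((Measurable.of_discrete (f := zeroIndicator)).comp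
      (hX.measurable_count _ (A.measurableSet_innerBetween _ _)))

theorem countOn_ne_top (hX : IsPoissonProcess X P) (hC : MeasurableSet C)
    (hCb : Bornology.IsBounded C) (ω : Ω) : countOn (X ω) C ≠ ∞ := by
  rw [countOn_apply _ hC]
  simpa using hX.locallyFinite ω C hCb

theorem lintegral_cellSum (hX : IsPoissonProcess X P) {ι : Type*} [Fintype ι]
    [MeasurableSpace ι] [MeasurableSingletonClass ι] {q : Plane → ι} (hq : Measurable q)
    (hC : MeasurableSet C) (hD : MeasurableSet D) (hCD : Disjoint C D)
    (hC' : volume C ≠ ∞) (hD' : volume D ≠ ∞) :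
    ∫⁻ ω, cellSum A C D q (countOn (X ω)) (fun V => zeroIndicator (X ω ∩ V).encard) ∂P =
      cellSum A C D q volume fun V => ENNReal.ofReal (Real.exp (-(volume V).toReal)) := by
  have hmC (s : ι) : MeasurableSet (C ∩ q ⁻¹' {s}) := hC.inter (hq (measurableSet_singleton s))
  have hmD (t : ι) : MeasurableSet (D ∩ q ⁻¹' {t}) := hD.inter (hq (measurableSet_singleton t))
  have hm (s t : ι) : Measurable fun ω => countOn (X ω) (C ∩ q ⁻¹' {s}) *
      countOn (X ω) (D ∩ q ⁻¹' {t}) * zeroIndicator (X ω ∩ cellBetween A C D q s t).encard :=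
    ((hX.measurable_countOn (hmC s)).mul (hX.measurable_countOn (hmD t))).mul
      ((Measurable.of_discrete (f := zeroIndicator)).comp
        (hX.measurable_count _ (A.measurableSet_innerBetween _ _)))
  unfold cellSum
  rw [lintegral_finsetSum _ fun s _ => Finset.measurable_sum _ fun t _ => hm s t]
  refine Finset.sum_congr rfl fun s _ => ?_
  rw [lintegral_finsetSum _ fun t _ => hm s t]
  refine Finset.sum_congr rfl fun t _ => ?_
  -- Empty cells contribute 0 to both sides; they are set aside because their inner set has infinite
  -- area and need not be disjoint from the other cell.
  rcases (C ∩ q ⁻¹' {s}).eq_empty_or_nonempty with hs | hs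
  · simp [hs]
  rcases (D ∩ q ⁻¹' {t}).eq_empty_or_nonempty with ht | ht
  · simp [ht]
  have hdis := hCD.mono (Set.inter_subset_left (t := q ⁻¹' {s}))
    (Set.inter_subset_left (t := q ⁻¹' {t}))
  obtain ⟨h1, h2⟩ := A.disjoint_innerBetween hdis hs ht
  obtain ⟨x, hx⟩ := hs
  obtain ⟨y, hy⟩ := ht
  simp_rw [countOn_apply _ (hmC s), countOn_apply _ (hmD t)]
  refine hX.lintegral_count_mul_count_mul_zeroIndicator (hmC s) (hmD t)
    (A.measurableSet_innerBetween _ _)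
    (measure_ne_top_of_subset Set.inter_subset_left hC')
    (measure_ne_top_of_subset Set.inter_subset_left hD')
    (measure_ne_top_of_subset (A.innerBetween_subset hx hy) ?_) hdis h1 h2
  rw [A.volume_between_eq_ofReal]; exact ENNReal.ofReal_ne_top

theorem pairMeasure_prod_of_disjoint (hX : IsPoissonProcess X P)
    (hC : MeasurableSet C) (hD : MeasurableSet D) (hCD : Disjoint C D)
    (hCb : Bornology.IsBounded C) (hDb : Bornology.IsBounded D) :
    (Measurable fun ω => pairMeasure A (X ω) (C ×ˢ D)) ∧
      ∫⁻ ω, pairMeasure A (X ω) (C ×ˢ D) ∂P =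
        ∫⁻ z in C ×ˢ D, ENNReal.ofReal (Real.exp (-(A.area * ‖z.2 - z.1‖ ^ 2))) := by
  obtain ⟨q, hq, hq'⟩ := exists_shrinking_partitions Plane
  have hlim (ω : Ω) := tendsto_cellSum_countOn (A := A) hq hq' hC hD hCD (hX.countable ω)
    (hX.countOn_ne_top hC hCb ω) (hX.countOn_ne_top hD hDb ω)
  have hmeas (n : ℕ) := hX.measurable_cellSum (A := A) (hq n) hC hD
  refine ⟨measurable_of_tendsto_metrizable hmeas (tendsto_pi_nhds.2 hlim), ?_⟩
  have hC' := hCb.measure_lt_top (μ := volume).ne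
  have hD' := hDb.measure_lt_top (μ := volume).ne
  have h1 := tendsto_lintegral_of_dominated_convergence
    (fun ω => countOn (X ω) C * countOn (X ω) D) hmeas
    (fun n => Filter.Eventually.of_forall fun ω => cellSum_le (hq n) hC hD
      (hX.countOn_ne_top hC hCb ω) (hX.countOn_ne_top hD hDb ω) fun V => zeroIndicator_le_one _)
    (by
      -- With `V = ∅` the void factor is 1, so the dominating product of counts has mean `volume C *
      -- volume D`.
      have := hX.lintegral_count_mul_count_mul_zeroIndicator hC hD MeasurableSet.empty hC' hD'
        (by simp) hCD (by simp) (by simp)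
      simp only [Set.inter_empty, Set.encard_empty, zeroIndicator, if_true, mul_one] at this
      simp_rw [countOn_apply _ hC, countOn_apply _ hD]
      rw [this]
      simpa using ENNReal.mul_ne_top hC' hD')
    (Filter.Eventually.of_forall hlim)
  refine tendsto_nhds_unique h1 ?_
  simp_rw [fun n => hX.lintegral_cellSum (A := A) (hq n) hC hD hCD hC' hD']
  exact tendsto_cellSum_volume hq hq' hC hD hCD hC' hD'

end IsPoissonProcess

/-! ### The intensity of the pairs of adjacent vertices -/

theorem exists_cover_offDiag (α : Type*) [MetricSpace α] [SecondCountableTopology α] [Nonempty α]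
    [MeasurableSpace α] [OpensMeasurableSpace α] :
    ∃ C D : ℕ → Set α, (∀ k, MeasurableSet (C k) ∧ MeasurableSet (D k) ∧ Disjoint (C k) (D k) ∧
      Bornology.IsBounded (C k) ∧ Bornology.IsBounded (D k)) ∧
      ∀ z : α × α, z.1 ≠ z.2 → ∃ k, z ∈ C k ×ˢ D k := by
  classical
  obtain ⟨e, he⟩ := exists_surjective_nat (ℕ × ℕ × ℕ)
  let d := TopologicalSpace.denseSeq α
  let r : ℕ → ℝ := fun n => 1 / ((n : ℝ) + 1)
  let C : ℕ × ℕ × ℕ → Set α := fun i => Metric.ball (d i.1) (r i.2.2)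
  let D : ℕ × ℕ × ℕ → Set α := fun i =>
    if r i.2.2 + r i.2.2 ≤ dist (d i.1) (d i.2.1) then Metric.ball (d i.2.1) (r i.2.2) else ∅
  refine ⟨C ∘ e, D ∘ e, fun k => ⟨measurableSet_ball, ?_, ?_, Metric.isBounded_ball, ?_⟩, ?_⟩
  · simp only [Function.comp, D]
    split_ifs
    exacts [measurableSet_ball, MeasurableSet.empty]
  · simp only [Function.comp, C, D]
    split_ifs with h
    exacts [Metric.ball_disjoint_ball h, disjoint_bot_right]
  · simp only [Function.comp, D]
    split_ifs
    exacts [Metric.isBounded_ball, Bornology.isBounded_empty]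
  · rintro ⟨x, y⟩ hxy
    -- With a radius `r n < dist x y / 4` and centres within `r n` of `x` and `y`, the centres are
    -- more than `2 * r n` apart, so the balls are disjoint.
    have hpos : 0 < dist x y / 4 := div_pos (dist_pos.2 hxy) (by norm_num)
    obtain ⟨n, hn⟩ := exists_nat_one_div_lt hpos
    have hr : 0 < r n := Nat.one_div_pos_of_nat
    obtain ⟨i, hi⟩ := (TopologicalSpace.denseRange_denseSeq α).exists_dist_lt x hr
    obtain ⟨j, hj⟩ := (TopologicalSpace.denseRange_denseSeq α).exists_dist_lt y hr
    obtain ⟨k, hk⟩ := he (i, j, n)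
    have hle : r n + r n ≤ dist (d i) (d j) := by
      have h1 := dist_triangle4 x (d i) (d j) y
      rw [dist_comm (d j) y] at h1
      have h2 : r n < dist x y / 4 := hn
      have h3 : dist x (d i) < r n := hi
      have h4 : dist y (d j) < r n := hj
      linarith
    refine ⟨k, ?_, ?_⟩
    · simpa [Function.comp, hk, C] using hi
    · simpa [Function.comp, hk, D, hle] using hj

theorem ae_fst_ne_snd : ∀ᵐ z : Plane × Plane, z.1 ≠ z.2 := by
  rw [ae_iff]
  have h : MeasurableSet {z : Plane × Plane | ¬ z.1 ≠ z.2} := by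
    simpa using measurableSet_eq_fun (measurable_fst (α := Plane) (β := Plane)) measurable_snd
  rw [Measure.volume_eq_prod, Measure.measure_prod_null h]
  refine Filter.Eventually.of_forall fun x => ?_
  refine measure_mono_null (t := {x}) (fun y hy => ?_) (measure_singleton x)
  have hy' : ¬ x ≠ y := hy
  exact (not_not.1 hy').symm

/-- The probability that two given vertices at `z.1` and `z.2` are adjacent. -/
def adjProb (A : Template) (z : Plane × Plane) : ℝ≥0∞ :=
  ENNReal.ofReal (Real.exp (-(A.area * ‖z.2 - z.1‖ ^ 2)))

theorem measurable_adjProb (A : Template) : Measurable (adjProb A) := by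
  unfold adjProb; fun_prop

theorem adjProb_le_one (A : Template) (z : Plane × Plane) : adjProb A z ≤ 1 := by
  rw [adjProb, ← ENNReal.ofReal_one]
  refine ENNReal.ofReal_le_ofReal (Real.exp_le_one_iff.2 ?_)
  have := A.area_pos
  simp only [Left.neg_nonpos_iff]
  positivity

/-! ### From product sets to sums of measurable functions over adjacent pairs -/

namespace IsPoissonProcess

variable {Ω : Type*} [MeasurableSpace Ω] {P : Measure Ω} {X : Ω → Set Plane}
  {A : Template} {C D : Set Plane}

theorem isFiniteMeasure_pairMeasure_restrict (hX : IsPoissonProcess X P) (hC : MeasurableSet C)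
    (hD : MeasurableSet D) (hCb : Bornology.IsBounded C) (hDb : Bornology.IsBounded D) (ω : Ω) :
    IsFiniteMeasure ((pairMeasure A (X ω)).restrict (C ×ˢ D)) := by
  have := sFinite_countOn (hX.countable ω)
  constructor
  rw [Measure.restrict_apply_univ]
  refine (Measure.restrict_apply_le _ _).trans_lt ?_
  rw [Measure.prod_prod]
  exact ENNReal.mul_lt_top (hX.countOn_ne_top hC hCb ω).lt_top (hX.countOn_ne_top hD hDb ω).lt_top

/-- The averaged pair measure `P.bind ρ` and the measure with density `adjProb A` agree on
rectangles, which determine a finite measure on the product. -/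
theorem lintegral_pairMeasure_restrict (hX : IsPoissonProcess X P)
    (hC : MeasurableSet C) (hD : MeasurableSet D) (hCD : Disjoint C D)
    (hCb : Bornology.IsBounded C) (hDb : Bornology.IsBounded D) {f : Plane × Plane → ℝ≥0∞}
    (hf : Measurable f) :
    (Measurable fun ω => ∫⁻ z in C ×ˢ D, f z ∂(pairMeasure A (X ω))) ∧
      ∫⁻ ω, ∫⁻ z in C ×ˢ D, f z ∂(pairMeasure A (X ω)) ∂P =
        ∫⁻ z in C ×ˢ D, adjProb A z * f z := by
  let ρ : Ω → Measure (Plane × Plane) := fun ω => (pairMeasure A (X ω)).restrict (C ×ˢ D)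
  have hfin (ω : Ω) : IsFiniteMeasure (ρ ω) :=
    hX.isFiniteMeasure_pairMeasure_restrict hC hD hCb hDb ω
  have hρ (s t : Set Plane) (hs : MeasurableSet s) (ht : MeasurableSet t) (ω : Ω) :
      ρ ω (s ×ˢ t) = pairMeasure A (X ω) ((s ∩ C) ×ˢ (t ∩ D)) := by
    rw [Measure.restrict_apply (hs.prod ht), Set.prod_inter_prod]
  have key (s t : Set Plane) (hs : MeasurableSet s) (ht : MeasurableSet t) :=
    hX.pairMeasure_prod_of_disjoint (A := A) (hs.inter hC) (ht.inter hD)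
      (hCD.mono Set.inter_subset_right Set.inter_subset_right)
      (hCb.subset Set.inter_subset_right) (hDb.subset Set.inter_subset_right)
  have hmρ (s t : Set Plane) (hs : MeasurableSet s) (ht : MeasurableSet t) :
      Measurable fun ω => ρ ω (s ×ˢ t) := by
    simp_rw [hρ s t hs ht]
    exact (key s t hs ht).1
  have hm : Measurable ρ := by
    refine Measurable.measure_of_isPiSystem generateFrom_prod.symm isPiSystem_prod ?_ ?_
    · rintro _ ⟨s, hs, t, ht, rfl⟩
      exact hmρ s t hs ht
    · rw [← Set.univ_prod_univ]
      exact hmρ _ _ MeasurableSet.univ MeasurableSet.univ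
  have hfin' : IsFiniteMeasure ((volume.restrict (C ×ˢ D)).withDensity (adjProb A)) := by
    refine isFiniteMeasure_withDensity (ne_top_of_le_ne_top ?_
      (lintegral_mono fun z => adjProb_le_one A z))
    rw [lintegral_one, Measure.restrict_apply_univ, Measure.volume_eq_prod, Measure.prod_prod]
    exact ENNReal.mul_ne_top hCb.measure_lt_top.ne hDb.measure_lt_top.ne
  have hbind : (volume.restrict (C ×ˢ D)).withDensity (adjProb A) = P.bind ρ := by
    refine Measure.ext_prod fun {s t} hs ht => ?_
    rw [Measure.bind_apply (hs.prod ht) hm.aemeasurable, withDensity_apply _ (hs.prod ht),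
      Measure.restrict_restrict (hs.prod ht), Set.prod_inter_prod]
    simp_rw [hρ s t hs ht]
    exact (key s t hs ht).2.symm
  refine ⟨(Measure.measurable_lintegral hf).comp hm, ?_⟩
  rw [← Measure.lintegral_bind hm.aemeasurable hf.aemeasurable, ← hbind,
    lintegral_withDensity_eq_lintegral_mul _ (measurable_adjProb A) hf]
  rfl

/-- The diagonal is null for the pair measure and for Lebesgue measure, so the cover by products
suffices. Its disjointed pieces `S k` are no longer products, hence each is handled inside `C k ×ˢ D
k` with `f` cut off to `S k`. -/
theorem lintegral_tsum_edgePairs (hX : IsPoissonProcess X P) (A : Template)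
    {f : Plane × Plane → ℝ≥0∞} (hf : Measurable f) :
    (Measurable fun ω => ∑' z : edgePairs A (X ω), f z) ∧
      ∫⁻ ω, ∑' z : edgePairs A (X ω), f z ∂P = ∫⁻ z, adjProb A z * f z := by
  obtain ⟨C, D, hCD, hcov⟩ := exists_cover_offDiag Plane
  have hmCD (k : ℕ) : MeasurableSet (C k ×ˢ D k) := (hCD k).1.prod (hCD k).2.1
  let S : ℕ → Set (Plane × Plane) := disjointed fun k => C k ×ˢ D k
  have hS (k : ℕ) : MeasurableSet (S k) := MeasurableSet.disjointed hmCD k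
  have hSsub (k : ℕ) : S k ⊆ C k ×ˢ D k := disjointed_subset _ k
  have hmem (z : Plane × Plane) (hz : z.1 ≠ z.2) : z ∈ ⋃ k, S k := by
    rw [iUnion_disjointed]
    exact Set.mem_iUnion.2 (hcov z hz)
  have hsplit (μ : Measure (Plane × Plane)) (hμ : ∀ᵐ z ∂μ, z.1 ≠ z.2)
      (g : Plane × Plane → ℝ≥0∞) : ∫⁻ z, g z ∂μ = ∑' k, ∫⁻ z in S k, g z ∂μ := by
    rw [← lintegral_iUnion hS (disjoint_disjointed _),
      Measure.restrict_eq_self_of_ae_mem (hμ.mono hmem)]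
  have hlocal (k : ℕ) := hX.lintegral_pairMeasure_restrict (A := A) (hCD k).1 (hCD k).2.1
    (hCD k).2.2.1 (hCD k).2.2.2.1 (hCD k).2.2.2.2 (hf.indicator (hS k))
  have hrestrict (μ : Measure (Plane × Plane)) (k : ℕ) (g : Plane × Plane → ℝ≥0∞) :
      ∫⁻ z in C k ×ˢ D k, (S k).indicator g z ∂μ = ∫⁻ z in S k, g z ∂μ := by
    rw [lintegral_indicator (hS k), Measure.restrict_restrict (hS k),
      Set.inter_eq_self_of_subset_left (hSsub k)]
  have heq (ω : Ω) : ∑' z : edgePairs A (X ω), f z =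
      ∑' k, ∫⁻ z in C k ×ˢ D k, (S k).indicator f z ∂(pairMeasure A (X ω)) := by
    rw [← lintegral_pairMeasure A (hX.countable ω),
      hsplit _ (ae_pairMeasure_fst_ne_snd A (hX.countable ω))]
    exact tsum_congr fun k => (hrestrict _ k f).symm
  simp_rw [heq]
  refine ⟨Measurable.tsum fun k => (hlocal k).1, ?_⟩
  rw [lintegral_tsum fun k => (hlocal k).1.aemeasurable, hsplit _ ae_fst_ne_snd]
  refine tsum_congr fun k => ?_
  rw [(hlocal k).2, ← hrestrict volume k]
  refine lintegral_congr fun z => ?_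
  by_cases hz : z ∈ S k <;> simp [hz]

end IsPoissonProcess

/-! ### Sums over edges and over neighbours as sums over pairs of adjacent vertices -/

/-- A pair of adjacent vertices is a vertex together with a neighbour of it. -/
def edgePairsEquiv (A : Template) (S : Set Plane) :
    edgePairs A S ≃ Σ x : S, (proximityGraph A S).neighborSet x where
  toFun z := ⟨⟨z.1.1, z.2.1⟩, ⟨z.1.2, z.2.2.1⟩,
    fun h => z.2.2.2.1 (congrArg Subtype.val h), z.2.2.2.2⟩
  invFun p := ⟨(p.1.1, p.2.1.1), p.1.2, p.2.1.2, fun h => p.2.2.1 (Subtype.ext h), p.2.2.2⟩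
  left_inv _ := rfl
  right_inv _ := rfl

theorem degreeSumIn_eq_tsum (A : Template) (S B : Set Plane) :
    degreeSumIn (proximityGraph A S) B =
      ∑' z : edgePairs A S, B.indicator (1 : Plane → ℝ≥0∞) z.1.1 := by
  rw [← (edgePairsEquiv A S).symm.tsum_eq, ENNReal.tsum_sigma']
  change _ = ∑' (x : S) (_ : (proximityGraph A S).neighborSet x),
    B.indicator (1 : Plane → ℝ≥0∞) x
  have h (x : S) : ∑' _ : (proximityGraph A S).neighborSet x,
      B.indicator (1 : Plane → ℝ≥0∞) x = {x : S | (x : Plane) ∈ B}.indicator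
        (fun x => (((proximityGraph A S).neighborSet x).encard : ℝ≥0∞)) x := by
    by_cases hx : (x : Plane) ∈ B
    · simp only [Set.indicator_of_mem hx, Pi.one_apply, ENNReal.tsum_set_one]
      rw [Set.indicator_of_mem (show x ∈ {x : S | (x : Plane) ∈ B} from hx)]
    · simp only [Set.indicator_of_notMem hx, tsum_zero]
      rw [Set.indicator_of_notMem (show x ∉ {x : S | (x : Plane) ∈ B} from hx)]
  rw [tsum_congr h, ← tsum_subtype]
  rfl

/-- The edge between two adjacent vertices. -/
def edgeOfPair (A : Template) (S : Set Plane) (z : edgePairs A S) : (proximityGraph A S).edgeSet :=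
  ⟨s(⟨z.1.1, z.2.1⟩, ⟨z.1.2, z.2.2.1⟩),
    fun h => z.2.2.2.1 (congrArg Subtype.val h), z.2.2.2.2⟩

theorem encard_edgeOfPair_fiber (A : Template) (S : Set Plane)
    (e : (proximityGraph A S).edgeSet) : {z | edgeOfPair A S z = e}.encard = 2 := by
  obtain ⟨e, he⟩ := e
  induction e with
  | _ x y =>
    have hadj : x ≠ y ∧ A.between x y ∩ S = ∅ := he
    have hne : (x : Plane) ≠ y := fun h => hadj.1 (Subtype.ext h)
    have h1 : ((x : Plane), (y : Plane)) ∈ edgePairs A S := ⟨x.2, y.2, hne, hadj.2⟩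
    have h2 : ((y : Plane), (x : Plane)) ∈ edgePairs A S :=
      ⟨y.2, x.2, hne.symm, A.between_swap x y ▸ hadj.2⟩
    have h : {z | edgeOfPair A S z = ⟨s(x, y), he⟩} =
        {⟨((x : Plane), (y : Plane)), h1⟩, ⟨((y : Plane), (x : Plane)), h2⟩} := by
      ext ⟨⟨u, v⟩, huv⟩
      simp [edgeOfPair, Subtype.ext_iff, Prod.ext_iff]
    rw [h, Set.encard_pair]
    intro h3
    exact hne (congrArg (fun z : edgePairs A S => z.1.1) h3)

theorem two_mul_lengthIn_eq_tsum (A : Template) (S B : Set Plane) :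
    2 * lengthIn (proximityGraph A S) B = ∑' z : edgePairs A S,
      (Measure.hausdorffMeasure 1 (segment ℝ z.1.1 z.1.2 ∩ B) : ℝ≥0∞) := by
  rw [lengthIn, ← ENNReal.tsum_mul_left, ← (Equiv.sigmaFiberEquiv (edgeOfPair A S)).tsum_eq,
    ENNReal.tsum_sigma']
  refine tsum_congr fun e => ?_
  have h (z : {z // edgeOfPair A S z = e}) :
      (Measure.hausdorffMeasure 1 (segment ℝ z.1.1.1 z.1.1.2 ∩ B) : ℝ≥0∞) =
        edgeLengthIn B (e : Sym2 S) := by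
    obtain ⟨z, rfl⟩ := z
    rfl
  change _ = ∑' z : {z // edgeOfPair A S z = e},
    (Measure.hausdorffMeasure 1 (segment ℝ z.1.1.1 z.1.1.2 ∩ B) : ℝ≥0∞)
  -- The summand is constant on the fibre; factoring it out leaves the number of ordered pairs over
  -- an edge.
  rw [tsum_congr h, ← one_mul (edgeLengthIn B (e : Sym2 S)), ENNReal.tsum_mul_right, one_mul]
  congr 1
  have h2 := ENNReal.tsum_set_one {z | edgeOfPair A S z = e}
  rw [encard_edgeOfPair_fiber] at h2
  exact h2.symm

end

theorem lemma1 {Ω : Type*} [MeasurableSpace Ω] (P : Measure Ω) [IsProbabilityMeasure P]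
    (X : Ω → Set Plane) (hX : IsPoissonProcess X P) (A : Template) :
    HasNormalizedLength P (fun ω => proximityGraph A (X ω))
        (Real.pi ^ (3 / 2 : ℝ) / (4 * A.area ^ (3 / 2 : ℝ))) ∧
      HasMeanDegree P (fun ω => proximityGraph A (X ω)) (Real.pi / A.area) := by
  have hA := A.area_pos
  refine ⟨⟨by positivity, fun B hB _ => ?_⟩, ⟨by positivity, fun B hB hB' => ?_⟩⟩
  · have hlen (ω : Ω) : lengthIn (proximityGraph A (X ω)) B = 2⁻¹ * ∑' z : edgePairs A (X ω),
        (Measure.hausdorffMeasure 1 (segment ℝ z.1.1 z.1.2 ∩ B) : ℝ≥0∞) := by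
      rw [← two_mul_lengthIn_eq_tsum, ← mul_assoc,
        ENNReal.inv_mul_cancel two_ne_zero ENNReal.ofNat_ne_top, one_mul]
    have hH := measurable_hausdorffMeasure_segment_inter hB
    obtain ⟨hm, hi⟩ := hX.lintegral_tsum_edgePairs A hH
    simp_rw [hlen]
    refine ⟨(hm.const_mul _).aemeasurable, ?_⟩
    rw [lintegral_const_mul _ hm, hi, Measure.volume_eq_prod,
      lintegral_prod (fun z => adjProb A z * _) ((measurable_adjProb A).mul hH).aemeasurable]
    simp_rw [adjProb, hausdorffMeasure_segment_inter, ← mul_assoc]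
    -- Here `g` weights the difference vector `z` by the void probability times the full segment
    -- length; the portion of the segment inside `B` is the remaining factor.
    rw [lintegral_mul_volume_Icc_inter_lineMap (g := fun z : Plane =>
      ENNReal.ofReal (Real.exp (-(A.area * ‖z‖ ^ 2))) * ‖z‖ₑ) hB (by fun_prop)]
    simp_rw [mul_comm (ENNReal.ofReal (Real.exp _))]
    rw [lintegral_plane_norm_mul_exp hA, ← mul_assoc, ← mul_assoc,
      ENNReal.inv_mul_cancel two_ne_zero ENNReal.ofNat_ne_top, one_mul]
  · have hI : Measurable fun z : Plane × Plane => B.indicator (1 : Plane → ℝ≥0∞) z.1 :=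
      (measurable_one.indicator hB).comp measurable_fst
    obtain ⟨hm, hi⟩ := hX.lintegral_tsum_edgePairs A hI
    simp_rw [degreeSumIn_eq_tsum]
    refine ⟨hm.aemeasurable, ?_⟩
    rw [hi, hX.lintegral_count hB hB', Measure.volume_eq_prod,
      lintegral_prod (fun z => adjProb A z * _) ((measurable_adjProb A).mul hI).aemeasurable]
    simp_rw [adjProb]
    have h (x : Plane) : ∫⁻ y : Plane, ENNReal.ofReal (Real.exp (-(A.area * ‖y - x‖ ^ 2))) *
        B.indicator (1 : Plane → ℝ≥0∞) x =
          ENNReal.ofReal (Real.pi / A.area) * B.indicator (1 : Plane → ℝ≥0∞) x := by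
      rw [lintegral_mul_const _ (by fun_prop), lintegral_sub_right_eq_self (fun z : Plane =>
        ENNReal.ofReal (Real.exp (-(A.area * ‖z‖ ^ 2)))), lintegral_plane_exp hA]
    simp_rw [h]
    rw [lintegral_const_mul _ (measurable_one.indicator hB), lintegral_indicator_one hB]
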